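/- Let $n\ge 1$, $m \ge 0$, let $A\in\mathbb R^{n\times n}$, $B\in\mathbb R^{n\times m}$, and let $Q=Q^\top\in\mathbb R^{n\times n}$ and $R=R^\top\in\mathbb R^{m\times m}$ be symmetric, not necessarily (semi)definite. Let $\rho$ denote the spectral radius, and let $\mathcal S=\{K\in\mathbb R^{m\times n}:\rho(A-BK)<1\}$ be the set of stabilizing gains. Let $z_1,\dots,z_n$ span $\mathbb R^n$, and for $K\in\mathcal S$ put $$f(K)=\sum_{i=1}^n\sum_{j=0}^\infty \big\langle (A-BK)^jz_i,\ (Q+K^\top RK)(A-BK)^jz_i\big\rangle .$$ Suppose that $K_*\in\mathcal S$ is a strict local minimizer of $f$ over $\mathcal S$: there is $\delta>0$ such that $f(K_*)<f(K)$ for all $K\in\mathcal S$ with $0<\|K-K_*\|_F<\delta$. Then the Lyapunov equation $$(A-BK_*)^\top X(A-BK_*)+Q+K_*^\top RK_*=X$$ has exactly one solution $X_*\in\mathbb R^{n\times n}$ (the value matrix of $K_*$), and: (a) $X_*=X_*^\top$; (b) $R+B^\top X_*B\succ0$; (c) $X_*$ solves the discrete algebraic Riccati equation (DARE) $$X=A^\top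 XA+Q-A^\top XB(R+B^\top XB)^{-1}B^\top XA,$$ where being a solution includes that $R+B^\top XB$ is invertible; (d) $K_*$ is the unique global minimizer of $f$ over $\mathcal S$, and it is the unique stationary point of $f$ in $\mathcal S$ (the unique $K\in\mathcal S$ at which $\nabla f(K)=0$); (e) $X_*$ is the maximal solution of the DARE, i.e. $X_*\succeq X$ for every symmetric solution $X\in\mathbb R^{n\times n}$; and $X_*$ is the unique almost stabilizing solution, i.e. the only solution $X\in\mathbb R^{n\times n}$ of the DARE with $\rho\big(A-B(R+B^\top XB)^{-1}B^\top XA\big)\le1$. -/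

import Mathlib

open Matrix

noncomputable section

namespace IndefiniteLQ

variable {n m : ℕ}

/-- The spectral radius `ρ(M)` of a real square matrix, computed from its complex eigenvalues. -/
def specRadius (M : Matrix (Fin n) (Fin n) ℝ) : ENNReal :=
  spectralRadius ℂ (M.map (fun x : ℝ => (x : ℂ)))

/-- The set `𝒮` of Schur stabilizing gains: `K` with `ρ(A - B K) < 1`. -/
def stabilizingSet (A : Matrix (Fin n) (Fin n) ℝ) (B : Matrix (Fin n) (Fin m) ℝ) :
    Set (Matrix (Fin m) (Fin n) ℝ) :=
  {K | specRadius (A - B * K) < 1}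

/-- The cost of `u_k = -K x_k` started at `x`:
`J_x(K) = ∑_j ⟨(A-BK)^j x, (Q + Kᵀ R K) (A-BK)^j x⟩` (absolutely convergent for `K ∈ 𝒮`). -/
def initialCost (A : Matrix (Fin n) (Fin n) ℝ) (B : Matrix (Fin n) (Fin m) ℝ)
    (Q : Matrix (Fin n) (Fin n) ℝ) (R : Matrix (Fin m) (Fin m) ℝ)
    (x : Fin n → ℝ) (K : Matrix (Fin m) (Fin n) ℝ) : ℝ :=
  ∑' j : ℕ, ((A - B * K) ^ j *ᵥ x) ⬝ᵥ ((Q + Kᵀ * R * K) *ᵥ ((A - B * K) ^ j *ᵥ x))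

/-- The cost `f(K) = ∑_i J_{z_i}(K)` for initial states `z_1, …, z_n`. -/
def cost (A : Matrix (Fin n) (Fin n) ℝ) (B : Matrix (Fin n) (Fin m) ℝ)
    (Q : Matrix (Fin n) (Fin n) ℝ) (R : Matrix (Fin m) (Fin m) ℝ)
    (z : Fin n → Fin n → ℝ) (K : Matrix (Fin m) (Fin n) ℝ) : ℝ :=
  ∑ i, initialCost A B Q R (z i) K

/-- The Frobenius norm. -/
def frobNorm (M : Matrix (Fin m) (Fin n) ℝ) : ℝ :=
  Real.sqrt (∑ i, ∑ j, M i j ^ 2)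

/-- `K₀` is a strict local minimizer of `f` over the set `S`. -/
def IsStrictLocalMinimizer (f : Matrix (Fin m) (Fin n) ℝ → ℝ)
    (S : Set (Matrix (Fin m) (Fin n) ℝ)) (K₀ : Matrix (Fin m) (Fin n) ℝ) : Prop :=
  K₀ ∈ S ∧ ∃ δ > 0, ∀ K ∈ S, K ≠ K₀ → frobNorm (K - K₀) < δ → f K₀ < f K

/-- `X` solves the Lyapunov equation `(A-BK)ᵀ X (A-BK) + Q + Kᵀ R K = X`; for `K ∈ 𝒮` its
solution is the value matrix of `K`. -/
def SolvesLyapunov (A : Matrix (Fin n) (Fin n) ℝ) (B : Matrix (Fin n) (Fin m) ℝ)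
    (Q : Matrix (Fin n) (Fin n) ℝ) (R : Matrix (Fin m) (Fin m) ℝ)
    (K : Matrix (Fin m) (Fin n) ℝ) (X : Matrix (Fin n) (Fin n) ℝ) : Prop :=
  (A - B * K)ᵀ * X * (A - B * K) + Q + Kᵀ * R * K = X

/-- `X` solves the discrete algebraic Riccati equation; this includes that the inverse
of `R + Bᵀ X B` occurring in it exists. -/
def SolvesDARE (A : Matrix (Fin n) (Fin n) ℝ) (B : Matrix (Fin n) (Fin m) ℝ)
    (Q : Matrix (Fin n) (Fin n) ℝ) (R : Matrix (Fin m) (Fin m) ℝ)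
    (X : Matrix (Fin n) (Fin n) ℝ) : Prop :=
  IsUnit (R + Bᵀ * X * B) ∧
    X = Aᵀ * X * A + Q - Aᵀ * X * B * (R + Bᵀ * X * B)⁻¹ * Bᵀ * X * A

/-- `X` is the maximal solution of the DARE in the Loewner order: it is a symmetric solution and
dominates every symmetric solution. -/
def IsMaximalDARESolution (A : Matrix (Fin n) (Fin n) ℝ) (B : Matrix (Fin n) (Fin m) ℝ)
    (Q : Matrix (Fin n) (Fin n) ℝ) (R : Matrix (Fin m) (Fin m) ℝ)
    (X : Matrix (Fin n) (Fin n) ℝ) : Prop :=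
  X.IsSymm ∧ SolvesDARE A B Q R X ∧
    ∀ X' : Matrix (Fin n) (Fin n) ℝ, X'.IsSymm → SolvesDARE A B Q R X' → (X - X').PosSemidef

/-- `X` is an almost stabilizing solution of the DARE: the closed loop matrix `A - B K_X` with
`K_X = (R + Bᵀ X B)⁻¹ Bᵀ X A` has all its eigenvalues in the closed unit disk. -/
def IsAlmostStabilizingDARESolution (A : Matrix (Fin n) (Fin n) ℝ) (B : Matrix (Fin n) (Fin m) ℝ)
    (Q : Matrix (Fin n) (Fin n) ℝ) (R : Matrix (Fin m) (Fin m) ℝ)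
    (X : Matrix (Fin n) (Fin n) ℝ) : Prop :=
  SolvesDARE A B Q R X ∧
    specRadius (A - B * ((R + Bᵀ * X * B)⁻¹ * Bᵀ * X * A)) ≤ 1

/-- `K` is a stationary point of `f`: `f` is differentiable at `K` with derivative zero. -/
def IsStationaryPoint (f : Matrix (Fin m) (Fin n) ℝ → ℝ) (K : Matrix (Fin m) (Fin n) ℝ) : Prop :=
  HasFDerivAt f (0 : Matrix (Fin m) (Fin n) ℝ →L[ℝ] ℝ) K

end IndefiniteLQ

end

/-! Everything rests on an exact comparison identity (`SolvesLyapunov.sub`). Let `X` be the value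
matrix of `K`, put `P = R + Bᵀ X B` and `G = P K - Bᵀ X A`, and let `K + D` have value matrix `X'`.
Then `X' - X` solves the Lyapunov equation of `A - B (K + D)` with weight `Dᵀ P D + Dᵀ G + Gᵀ D`.
The cost difference is therefore the sum of this form along the orbits of the new closed loop, and
no derivative of `X` is needed.

Taking `D = -t G` gives a first-order decrease unless `G = 0`, so `G` vanishes at local minimizers
and at stationary points (`gradFactor_eq_zero`). Once `G = 0`, only `Dᵀ P D` remains. Rank-one
perturbations and strictness force `P` to be positive definite
(`weight_posDef_of_isStrictLocalMinimizer`), and the sum of squares then makes the gain globally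
optimal. `G = 0` also turns the Lyapunov equation into the DARE.

For any other DARE solution `X` with closed loop `N`, the difference `Δ = X_* - X` satisfies `Δ = Mᵀ
Δ N`, where `M = A - B K_*` is stable (`dare_sub_eq`). If `N` is almost stable, iteration gives `Δ =
0`. If `X` is symmetric, the form of `Δ` does not decrease along `N`. Running `N` backwards modulo
`ker Δ`, where `Mᵀ` contracts, gives `Δ ⪰ 0` (`nonneg_of_fixed_of_nondecreasing`). -/

namespace IndefiniteLQ

open Filter Topology

/-! ### Spectral radius and decay of matrix powers -/

section SpectralRadius

attribute [local instance] Matrix.linftyOpNormedRing Matrix.linftyOpNormedAlgebra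

lemma norm_entry_le_linftyOpNorm {n : ℕ} (M : Matrix (Fin n) (Fin n) ℂ) (a b : Fin n) :
    ‖M a b‖ ≤ ‖M‖ := by
  rw [Matrix.linfty_opNorm_def]
  have h1 : ‖M a b‖₊ ≤ ∑ j, ‖M a j‖₊ :=
    Finset.single_le_sum (f := fun j => ‖M a j‖₊) (fun _ _ => zero_le) (Finset.mem_univ b)
  have h2 : (∑ j, ‖M a j‖₊) ≤ Finset.univ.sup fun i => ∑ j, ‖M i j‖₊ :=
    Finset.le_sup (f := fun i => ∑ j, ‖M i j‖₊) (Finset.mem_univ a)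
  exact_mod_cast h1.trans h2

/-- Gelfand's formula gives the bound for all large `j`; the finitely many remaining powers are
absorbed into `C`. -/
lemma exists_abs_pow_entry_le {n : ℕ} (M : Matrix (Fin n) (Fin n) ℝ) {r : NNReal}
    (hr : 0 < r) (h : specRadius M < r) :
    ∃ C : ℝ, 0 ≤ C ∧ ∀ (j : ℕ) (a b : Fin n), |(M ^ j) a b| ≤ C * (r : ℝ) ^ j := by
  set N : Matrix (Fin n) (Fin n) ℂ := M.map (fun x : ℝ => (x : ℂ)) with hN
  have hpow : ∀ j : ℕ, N ^ j = (M ^ j).map (fun x : ℝ => (x : ℂ)) := fun j =>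
    (Matrix.map_pow M Complex.ofRealHom j).symm
  have hent : ∀ (j : ℕ) (a b : Fin n), |(M ^ j) a b| ≤ ‖N ^ j‖ := fun j a b => by
    have := norm_entry_le_linftyOpNorm (N ^ j) a b
    rw [hpow] at this ⊢
    simpa using this
  have hlim := spectrum.pow_nnnorm_pow_one_div_tendsto_nhds_spectralRadius N
  have hev : ∀ᶠ j : ℕ in atTop, ‖N ^ j‖ ≤ (r : ℝ) ^ j := by
    filter_upwards [hlim.eventually (gt_mem_nhds h), eventually_gt_atTop 0] with j hj hj0
    have hj' : (0 : ℝ) < j := by exact_mod_cast hj0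
    rw [one_div, ENNReal.rpow_inv_lt_iff hj', ENNReal.rpow_natCast] at hj
    exact_mod_cast hj.le
  obtain ⟨J, hJ⟩ := eventually_atTop.1 hev
  have hr' : (0 : ℝ) < r := hr
  refine ⟨1 + ∑ k ∈ Finset.range J, ‖N ^ k‖ / (r : ℝ) ^ k, by positivity, fun j a b => ?_⟩
  refine (hent j a b).trans ?_
  have hS : 0 ≤ ∑ k ∈ Finset.range J, ‖N ^ k‖ / (r : ℝ) ^ k := by positivity
  rcases le_or_gt J j with hj | hj
  · calc ‖N ^ j‖ ≤ (r : ℝ) ^ j := hJ j hj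
      _ ≤ _ := le_mul_of_one_le_left (by positivity) (by linarith)
  · have : ‖N ^ j‖ / (r : ℝ) ^ j ≤ ∑ k ∈ Finset.range J, ‖N ^ k‖ / (r : ℝ) ^ k :=
      Finset.single_le_sum (f := fun k => ‖N ^ k‖ / (r : ℝ) ^ k) (fun _ _ => by positivity)
        (Finset.mem_range.2 hj)
    rw [← div_le_iff₀ (by positivity)]
    linarith

lemma specRadius_lt_one_of_tendsto {n : ℕ} (M : Matrix (Fin n) (Fin n) ℝ)
    (h : ∀ a b, Tendsto (fun j : ℕ => (M ^ j) a b) atTop (𝓝 0)) : specRadius M < 1 := by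
  set N : Matrix (Fin n) (Fin n) ℂ := M.map (fun x : ℝ => (x : ℂ)) with hN
  have hpow : ∀ j : ℕ, N ^ j = (M ^ j).map (fun x : ℝ => (x : ℂ)) := fun j =>
    (Matrix.map_pow M Complex.ofRealHom j).symm
  have hbound : ∀ j : ℕ, ‖N ^ j‖ ≤ ∑ a, ∑ b, |(M ^ j) a b| := fun j => by
    rw [hpow, Matrix.linfty_opNorm_def]
    have : (Finset.univ.sup fun i => ∑ k, ‖((M ^ j).map (fun x : ℝ => (x : ℂ))) i k‖₊) ≤
        ∑ i, ∑ k, ‖((M ^ j).map (fun x : ℝ => (x : ℂ))) i k‖₊ :=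
      Finset.sup_le fun i hi => Finset.single_le_sum
        (f := fun i => ∑ k, ‖((M ^ j).map (fun x : ℝ => (x : ℂ))) i k‖₊) (fun _ _ => zero_le) hi
    have h2 := NNReal.coe_le_coe.2 this
    push_cast at h2
    simpa using h2
  have hsum : Tendsto (fun j : ℕ => (∑ a, ∑ b, |(M ^ j) a b|) * ‖(1 : Matrix (Fin n) (Fin n) ℂ)‖)
      atTop (𝓝 0) := by
    have : Tendsto (fun j : ℕ => (∑ a, ∑ b, |(M ^ j) a b|) * ‖(1 : Matrix (Fin n) (Fin n) ℂ)‖)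
        atTop (𝓝 ((∑ _a : Fin n, ∑ _b : Fin n, |(0 : ℝ)|) * ‖(1 : Matrix (Fin n) (Fin n) ℂ)‖)) :=
      (tendsto_finsetSum _ fun a _ => tendsto_finsetSum _ fun b _ => (h a b).abs).mul_const _
    simpa using this
  obtain ⟨J, hJ⟩ := eventually_atTop.1 (hsum.eventually (gt_mem_nhds one_pos))
  -- One power of small norm suffices. The factor `‖1‖` is kept because it is `0`, not `1`, when `n
  -- = 0`.
  have h1 : ‖N ^ (J + 1)‖ * ‖(1 : Matrix (Fin n) (Fin n) ℂ)‖ < 1 :=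
    (mul_le_mul_of_nonneg_right (hbound _) (norm_nonneg _)).trans_lt (hJ (J + 1) (by omega))
  have h2 := spectrum.spectralRadius_le_pow_nnnorm_pow_one_div ℂ N J
  refine lt_of_le_of_lt h2 ?_
  rw [← ENNReal.mul_rpow_of_nonneg _ _ (by positivity)]
  refine ENNReal.rpow_lt_one ?_ (by positivity)
  exact_mod_cast h1

end SpectralRadius

lemma tendsto_pow_entry_of_specRadius_lt_one {n : ℕ} {M : Matrix (Fin n) (Fin n) ℝ}
    (h : specRadius M < 1) (a b : Fin n) : Tendsto (fun j : ℕ => (M ^ j) a b) atTop (𝓝 0) := by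
  obtain ⟨r, h1, h2⟩ := ENNReal.lt_iff_exists_nnreal_btwn.1 h
  have hr : 0 < r := by
    have : (0 : ENNReal) < r := lt_of_le_of_lt zero_le h1
    exact_mod_cast this
  have hr1 : (r : ℝ) < 1 := by exact_mod_cast h2
  obtain ⟨C, -, hC⟩ := exists_abs_pow_entry_le M hr h1
  refine squeeze_zero_norm (fun j => hC j a b) ?_
  simpa using (tendsto_pow_atTop_nhds_zero_of_lt_one r.2 hr1).const_mul C

lemma tendsto_pow_of_specRadius_lt_one {n : ℕ} {M : Matrix (Fin n) (Fin n) ℝ}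
    (h : specRadius M < 1) : Tendsto (fun j : ℕ => M ^ j) atTop (𝓝 0) :=
  tendsto_pi_nhds.2 fun a => tendsto_pi_nhds.2 fun b =>
    tendsto_pow_entry_of_specRadius_lt_one h a b

lemma tendsto_pow_mulVec_of_specRadius_lt_one {n : ℕ} {M : Matrix (Fin n) (Fin n) ℝ}
    (h : specRadius M < 1) (x : Fin n → ℝ) : Tendsto (fun j : ℕ => M ^ j *ᵥ x) atTop (𝓝 0) := by
  have : Continuous fun N : Matrix (Fin n) (Fin n) ℝ => N *ᵥ x := by fun_prop
  simpa [Function.comp_def] using (this.tendsto 0).comp (tendsto_pow_of_specRadius_lt_one h)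

/-- A Sylvester-type fixed point `D = Mᵀ D N` vanishes when `M` is Schur stable and `N` is
almost stable. -/
lemma eq_zero_of_eq_transpose_mul_mul {n : ℕ} {M N D : Matrix (Fin n) (Fin n) ℝ}
    (hM : specRadius M < 1) (hN : specRadius N ≤ 1) (h : D = Mᵀ * D * N) : D = 0 := by
  obtain ⟨r, h1, h2⟩ := ENNReal.lt_iff_exists_nnreal_btwn.1 hM
  have hr : 0 < r := by
    have : (0 : ENNReal) < r := lt_of_le_of_lt zero_le h1
    exact_mod_cast this
  have hr1 : r < 1 := by exact_mod_cast h2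
  -- The powers of `N` may grow, but at a rate `s > 1` arbitrarily close to `1`. With `s < r⁻¹` the
  -- decay of `M` wins in `(Mᵀ) ^ j * D * N ^ j`.
  obtain ⟨s, hs1, hs2⟩ := exists_between ((one_lt_inv₀ hr).2 hr1)
  have hs0 : 0 < s := one_pos.trans hs1
  have hrs : (r : ℝ) * s < 1 := by
    have : r * s < r * r⁻¹ := by gcongr
    rw [mul_inv_cancel₀ hr.ne'] at this
    exact_mod_cast this
  obtain ⟨C, hC0, hC⟩ := exists_abs_pow_entry_le M hr h1
  obtain ⟨C', hC0', hC'⟩ := exists_abs_pow_entry_le N hs0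
    (lt_of_le_of_lt hN (by exact_mod_cast hs1 : (1 : ENNReal) < s))
  have hiter : ∀ j : ℕ, D = (Mᵀ) ^ j * D * N ^ j := by
    intro j
    induction j with
    | zero => simp
    | succ k ih =>
      calc D = (Mᵀ) ^ k * D * N ^ k := ih
        _ = (Mᵀ) ^ k * (Mᵀ * D * N) * N ^ k := by rw [← h]
        _ = _ := by rw [pow_succ, pow_succ']; simp only [Matrix.mul_assoc]
  ext a b
  have hb : ∀ j : ℕ, ‖D a b‖ ≤ (∑ l, ∑ k, C * |D k l| * C') * ((r : ℝ) * s) ^ j := by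
    intro j
    conv_lhs => rw [hiter j]
    rw [← Matrix.transpose_pow, Matrix.mul_apply, Finset.sum_mul]
    refine (norm_sum_le _ _).trans (Finset.sum_le_sum fun l _ => ?_)
    rw [Matrix.mul_apply, Finset.sum_mul, Finset.sum_mul]
    refine (norm_sum_le _ _).trans (Finset.sum_le_sum fun k _ => ?_)
    rw [norm_mul, norm_mul, Matrix.transpose_apply, mul_pow]
    calc _ ≤ (C * (r : ℝ) ^ j) * |D k l| * (C' * (s : ℝ) ^ j) := by
          gcongr
          · exact hC j k a
          · exact le_rfl
          · exact hC' j l b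
      _ = _ := by ring
  have hlim : Tendsto (fun j : ℕ => (∑ l, ∑ k, C * |D k l| * C') * ((r : ℝ) * s) ^ j)
      atTop (𝓝 0) := by
    simpa using (tendsto_pow_atTop_nhds_zero_of_lt_one (by positivity) hrs).const_mul
      (∑ l, ∑ k, C * |D k l| * C')
  have := ge_of_tendsto' hlim hb
  simpa using this

/-! ### Lyapunov equations and quadratic sums along orbits -/

section StabilityBounds

variable {n m : ℕ}

/-- The sum of the absolute values of the entries, a crude bound for the quadratic form. -/
def absSum {k : ℕ} (W : Matrix (Fin k) (Fin k) ℝ) : ℝ := ∑ i, ∑ j, |W i j|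

lemma absSum_nonneg {k : ℕ} (W : Matrix (Fin k) (Fin k) ℝ) : 0 ≤ absSum W := by
  unfold absSum; positivity

lemma dotProduct_self_nonneg' {k : ℕ} (x : Fin k → ℝ) : 0 ≤ x ⬝ᵥ x :=
  Finset.sum_nonneg fun i _ => mul_self_nonneg (x i)

lemma abs_dotProduct_mulVec_le {k : ℕ} (W : Matrix (Fin k) (Fin k) ℝ) (x : Fin k → ℝ) :
    |x ⬝ᵥ (W *ᵥ x)| ≤ absSum W * (x ⬝ᵥ x) := by
  have hsq : ∀ i, x i * x i ≤ x ⬝ᵥ x := fun i =>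
    Finset.single_le_sum (f := fun i => x i * x i) (fun i _ => mul_self_nonneg (x i))
      (Finset.mem_univ i)
  have hexp : x ⬝ᵥ (W *ᵥ x) = ∑ i, ∑ j, x i * (W i j * x j) := by
    simp only [dotProduct, mulVec, Finset.mul_sum]
  rw [hexp, absSum, Finset.sum_mul]
  refine (Finset.abs_sum_le_sum_abs _ _).trans (Finset.sum_le_sum fun i _ => ?_)
  rw [Finset.sum_mul]
  refine (Finset.abs_sum_le_sum_abs _ _).trans (Finset.sum_le_sum fun j _ => ?_)
  rw [abs_mul, abs_mul]
  have h1 := hsq i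
  have h2 := hsq j
  have h3 : |x i| * |x j| ≤ x ⬝ᵥ x := by
    have := two_mul_le_add_sq |x i| |x j|
    rw [sq_abs, sq_abs] at this
    nlinarith
  calc |x i| * (|W i j| * |x j|) = |W i j| * (|x i| * |x j|) := by ring
    _ ≤ _ := mul_le_mul_of_nonneg_left h3 (abs_nonneg _)

lemma mulVec_dotProduct_mulVec_mulVec {k l : ℕ} (M : Matrix (Fin l) (Fin k) ℝ)
    (W : Matrix (Fin l) (Fin l) ℝ) (x : Fin k → ℝ) :
    (M *ᵥ x) ⬝ᵥ (W *ᵥ (M *ᵥ x)) = x ⬝ᵥ ((Mᵀ * W * M) *ᵥ x) := by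
  rw [Matrix.mulVec_mulVec, Matrix.mul_assoc, ← Matrix.mulVec_mulVec x Mᵀ,
    Matrix.dotProduct_mulVec x Mᵀ, Matrix.vecMul_transpose]

lemma pow_succ_mulVec (M : Matrix (Fin n) (Fin n) ℝ) (x : Fin n → ℝ) (j : ℕ) :
    M ^ (j + 1) *ᵥ x = M *ᵥ (M ^ j *ᵥ x) := by
  rw [pow_succ', Matrix.mulVec_mulVec]

section Lyapunov

variable {M : Matrix (Fin n) (Fin n) ℝ} (hM : specRadius M < 1)
include hM

/-- The homogeneous equation has only the zero solution, and an injective endomorphism of a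
finite-dimensional space is surjective. -/
lemma existsUnique_lyapunov (W : Matrix (Fin n) (Fin n) ℝ) :
    ∃! X : Matrix (Fin n) (Fin n) ℝ, Mᵀ * X * M + W = X := by
  let φ : Matrix (Fin n) (Fin n) ℝ →ₗ[ℝ] Matrix (Fin n) (Fin n) ℝ :=
    { toFun := fun X => X - Mᵀ * X * M
      map_add' := fun X Y => by simp only [Matrix.mul_add, Matrix.add_mul]; abel
      map_smul' := fun c X => by simp [smul_sub] }
  have hinj : Function.Injective φ := by
    rw [injective_iff_map_eq_zero]
    intro X hX
    exact eq_zero_of_eq_transpose_mul_mul hM hM.le (sub_eq_zero.1 hX)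
  obtain ⟨X, hX⟩ := LinearMap.injective_iff_surjective.1 hinj W
  have hφ : ∀ Y, φ Y = Y - Mᵀ * Y * M := fun _ => rfl
  refine ⟨X, ?_, fun Y hY => hinj ?_⟩
  · change Mᵀ * X * M + W = X
    rw [← hX, hφ]; abel
  · rw [hX, hφ, sub_eq_iff_eq_add']
    exact hY.symm

omit hM in
lemma sum_range_lyapunov {X W : Matrix (Fin n) (Fin n) ℝ} (h : Mᵀ * X * M + W = X)
    (x : Fin n → ℝ) (N : ℕ) :
    ∑ j ∈ Finset.range N, (M ^ j *ᵥ x) ⬝ᵥ (W *ᵥ (M ^ j *ᵥ x)) =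
      x ⬝ᵥ (X *ᵥ x) - (M ^ N *ᵥ x) ⬝ᵥ (X *ᵥ (M ^ N *ᵥ x)) := by
  induction N with
  | zero => simp
  | succ N ih =>
    rw [Finset.sum_range_succ, ih, pow_succ_mulVec, mulVec_dotProduct_mulVec_mulVec M X,
      eq_sub_of_add_eq h, Matrix.sub_mulVec, dotProduct_sub]
    ring

lemma tendsto_sum_lyapunov {X W : Matrix (Fin n) (Fin n) ℝ} (h : Mᵀ * X * M + W = X)
    (x : Fin n → ℝ) :
    Tendsto (fun N => ∑ j ∈ Finset.range N, (M ^ j *ᵥ x) ⬝ᵥ (W *ᵥ (M ^ j *ᵥ x))) atTop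
      (𝓝 (x ⬝ᵥ (X *ᵥ x))) := by
  simp only [sum_range_lyapunov h]
  have hc : Continuous fun y : Fin n → ℝ => y ⬝ᵥ (X *ᵥ y) := by fun_prop
  have := (hc.tendsto 0).comp (tendsto_pow_mulVec_of_specRadius_lt_one hM x)
  simpa [Function.comp_def] using tendsto_const_nhds.sub this

/-- With weight `1` the terms are nonnegative and the partial sums telescope to a limit. Indefinite
weights are then handled by domination. -/
lemma summable_orbit_sq (x : Fin n → ℝ) :
    Summable fun j : ℕ => (M ^ j *ᵥ x) ⬝ᵥ (M ^ j *ᵥ x) := by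
  obtain ⟨Y, hY, -⟩ := existsUnique_lyapunov hM 1
  have := tendsto_sum_lyapunov hM hY x
  simp only [Matrix.one_mulVec] at this
  exact ((hasSum_iff_tendsto_nat_of_nonneg (fun j => dotProduct_self_nonneg' _) _).2 this).summable

lemma summable_orbit_quadratic (W : Matrix (Fin n) (Fin n) ℝ) (x : Fin n → ℝ) :
    Summable fun j : ℕ => (M ^ j *ᵥ x) ⬝ᵥ (W *ᵥ (M ^ j *ᵥ x)) :=
  Summable.of_norm_bounded ((summable_orbit_sq hM x).mul_left (absSum W))
    fun _ => abs_dotProduct_mulVec_le W _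

lemma hasSum_lyapunov {X W : Matrix (Fin n) (Fin n) ℝ} (h : Mᵀ * X * M + W = X)
    (x : Fin n → ℝ) :
    HasSum (fun j : ℕ => (M ^ j *ᵥ x) ⬝ᵥ (W *ᵥ (M ^ j *ᵥ x))) (x ⬝ᵥ (X *ᵥ x)) :=
  (summable_orbit_quadratic hM W x).hasSum_iff_tendsto_nat.2 (tendsto_sum_lyapunov hM h x)

end Lyapunov

/-- If a quadratic form decreases along `M` by at least half of the squared Euclidean norm, and is
nonnegative, then `M` is Schur stable. -/
lemma specRadius_lt_one_of_decrease {M Y : Matrix (Fin n) (Fin n) ℝ}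
    (hY : ∀ x, 0 ≤ x ⬝ᵥ (Y *ᵥ x))
    (h : ∀ x, (M *ᵥ x) ⬝ᵥ (Y *ᵥ (M *ᵥ x)) ≤ x ⬝ᵥ (Y *ᵥ x) - (x ⬝ᵥ x) / 2) :
    specRadius M < 1 ∧ ∀ x, ∑' j : ℕ, (M ^ j *ᵥ x) ⬝ᵥ (M ^ j *ᵥ x) ≤ 2 * (x ⬝ᵥ (Y *ᵥ x)) := by
  have hpart : ∀ (x : Fin n → ℝ) (N : ℕ),
      ∑ j ∈ Finset.range N, (M ^ j *ᵥ x) ⬝ᵥ (M ^ j *ᵥ x) +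
        2 * ((M ^ N *ᵥ x) ⬝ᵥ (Y *ᵥ (M ^ N *ᵥ x))) ≤ 2 * (x ⬝ᵥ (Y *ᵥ x)) := by
    intro x N
    induction N with
    | zero => simp
    | succ N ih =>
      rw [Finset.sum_range_succ, pow_succ_mulVec]
      have := h (M ^ N *ᵥ x)
      linarith
  have hle : ∀ (x : Fin n → ℝ) (N : ℕ),
      ∑ j ∈ Finset.range N, (M ^ j *ᵥ x) ⬝ᵥ (M ^ j *ᵥ x) ≤ 2 * (x ⬝ᵥ (Y *ᵥ x)) := fun x N => by
    have := hpart x N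
    have := hY (M ^ N *ᵥ x)
    linarith
  have hsum : ∀ x : Fin n → ℝ, Summable fun j : ℕ => (M ^ j *ᵥ x) ⬝ᵥ (M ^ j *ᵥ x) := fun x =>
    summable_of_sum_range_le (fun j => dotProduct_self_nonneg' _) (hle x)
  refine ⟨specRadius_lt_one_of_tendsto M fun a b => ?_, fun x =>
    Real.tsum_le_of_sum_range_le (fun j => dotProduct_self_nonneg' _) (hle x)⟩
  have h0 := (hsum (Pi.single b 1)).tendsto_atTop_zero
  have h1 : Tendsto (fun j : ℕ => ((M ^ j) a b) ^ 2) atTop (𝓝 0) := by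
    refine squeeze_zero (fun j => sq_nonneg _) (fun j => ?_) h0
    rw [Matrix.mulVec_single_one]
    have := Finset.single_le_sum (f := fun i => (M ^ j) i b * (M ^ j) i b)
      (fun i _ => mul_self_nonneg _) (Finset.mem_univ a)
    simpa [sq, dotProduct, Matrix.col] using this
  have h2 := h1.sqrt
  simp only [Real.sqrt_sq_eq_abs, Real.sqrt_zero] at h2
  exact (tendsto_zero_iff_abs_tendsto_zero _).2 h2

/-- Near a stabilizing gain all gains are stabilizing, with locally uniform bounds on the sums of
squares along closed-loop trajectories. -/
lemma eventually_mem_stabilizingSet {A : Matrix (Fin n) (Fin n) ℝ} {B : Matrix (Fin n) (Fin m) ℝ}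
    {K : Matrix (Fin m) (Fin n) ℝ} (hK : K ∈ stabilizingSet A B) :
    ∃ Y : Matrix (Fin n) (Fin n) ℝ, ∀ᶠ L in 𝓝 K, L ∈ stabilizingSet A B ∧
      ∀ x, ∑' j : ℕ, ((A - B * L) ^ j *ᵥ x) ⬝ᵥ ((A - B * L) ^ j *ᵥ x) ≤ 2 * (x ⬝ᵥ (Y *ᵥ x)) := by
  obtain ⟨Y, hY, -⟩ := existsUnique_lyapunov hK 1
  have hY0 : ∀ x, 0 ≤ x ⬝ᵥ (Y *ᵥ x) := fun x =>
    (hasSum_lyapunov hK hY x).nonneg fun j => by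
      rw [Matrix.one_mulVec]; exact dotProduct_self_nonneg' _
  refine ⟨Y, ?_⟩
  let g : Matrix (Fin m) (Fin n) ℝ → ℝ := fun L =>
    absSum ((A - B * L)ᵀ * Y * (A - B * L) - (A - B * K)ᵀ * Y * (A - B * K))
  have hg : Continuous g := by
    unfold g absSum
    fun_prop
  have hg0 : g K = 0 := by simp [g, absSum]
  -- Along `A - B * K` the form of `Y` drops by exactly `x ⬝ᵥ x`; a perturbation of size below `1 /
  -- 2` leaves at least half of that drop.
  have hev : ∀ᶠ L in 𝓝 K, g L < 1 / 2 :=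
    (hg.tendsto K).eventually (gt_mem_nhds (by rw [hg0]; norm_num))
  filter_upwards [hev] with L hL
  refine specRadius_lt_one_of_decrease (M := A - B * L) hY0 fun x => ?_
  have h1 := (abs_le.1 (abs_dotProduct_mulVec_le
    ((A - B * L)ᵀ * Y * (A - B * L) - (A - B * K)ᵀ * Y * (A - B * K)) x)).2
  have h2 := mul_le_mul_of_nonneg_right hL.le (dotProduct_self_nonneg' x)
  have h3 : (A - B * K)ᵀ * Y * (A - B * K) = Y - 1 := eq_sub_of_add_eq hY
  rw [Matrix.sub_mulVec, dotProduct_sub, h3, Matrix.sub_mulVec, dotProduct_sub,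
    Matrix.one_mulVec] at h1
  simp only [g, h3] at h2
  rw [mulVec_dotProduct_mulVec_mulVec]
  linarith

end StabilityBounds

/-! ### Comparison of two gains and the gradient factor -/

section LinearQuadratic

variable {n m : ℕ} {A : Matrix (Fin n) (Fin n) ℝ} {B : Matrix (Fin n) (Fin m) ℝ}
  {Q : Matrix (Fin n) (Fin n) ℝ} {R : Matrix (Fin m) (Fin m) ℝ}

/-- The matrix `(R + Bᵀ X B) K - Bᵀ X A`, which for the value matrix `X` of `K` is the factor
of the gradient of the cost that does not depend on the initial states. -/
def gradFactor (A : Matrix (Fin n) (Fin n) ℝ) (B : Matrix (Fin n) (Fin m) ℝ)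
    (R : Matrix (Fin m) (Fin m) ℝ) (K : Matrix (Fin m) (Fin n) ℝ) (X : Matrix (Fin n) (Fin n) ℝ) :
    Matrix (Fin m) (Fin n) ℝ :=
  (R + Bᵀ * X * B) * K - Bᵀ * X * A

lemma SolvesLyapunov.eq_add {K : Matrix (Fin m) (Fin n) ℝ} {X : Matrix (Fin n) (Fin n) ℝ}
    (h : SolvesLyapunov A B Q R K X) : (A - B * K)ᵀ * X * (A - B * K) + (Q + Kᵀ * R * K) = X := by
  rw [← add_assoc]; exact h

lemma solvesLyapunov_iff {K : Matrix (Fin m) (Fin n) ℝ} {X : Matrix (Fin n) (Fin n) ℝ} :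
    SolvesLyapunov A B Q R K X ↔
      (A - B * K)ᵀ * X * (A - B * K) + (Q + Kᵀ * R * K) = X := by
  rw [← add_assoc]; rfl

lemma existsUnique_solvesLyapunov {K : Matrix (Fin m) (Fin n) ℝ} (hK : K ∈ stabilizingSet A B) :
    ∃! X, SolvesLyapunov A B Q R K X := by
  simp only [solvesLyapunov_iff]
  exact existsUnique_lyapunov hK _

lemma SolvesLyapunov.isSymm (hQ : Q.IsSymm) (hR : R.IsSymm) {K : Matrix (Fin m) (Fin n) ℝ}
    (hK : K ∈ stabilizingSet A B) {X : Matrix (Fin n) (Fin n) ℝ}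
    (h : SolvesLyapunov A B Q R K X) : X.IsSymm := by
  refine (existsUnique_solvesLyapunov (Q := Q) (R := R) hK).unique ?_ h
  have := congrArg Matrix.transpose h
  simpa [SolvesLyapunov, Matrix.mul_assoc, hQ.eq, hR.eq] using this

lemma SolvesLyapunov.initialCost_eq {K : Matrix (Fin m) (Fin n) ℝ} (hK : K ∈ stabilizingSet A B)
    {X : Matrix (Fin n) (Fin n) ℝ} (h : SolvesLyapunov A B Q R K X) (x : Fin n → ℝ) :
    initialCost A B Q R x K = x ⬝ᵥ (X *ᵥ x) :=
  (hasSum_lyapunov hK h.eq_add x).tsum_eq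

/-- The difference of two solutions of Lyapunov equations solves a Lyapunov equation. -/
lemma SolvesLyapunov.sub (hR : R.IsSymm) {K D : Matrix (Fin m) (Fin n) ℝ}
    {X X' : Matrix (Fin n) (Fin n) ℝ} (hX : X.IsSymm) (h : SolvesLyapunov A B Q R K X)
    (h' : SolvesLyapunov A B Q R (K + D) X') :
    (A - B * (K + D))ᵀ * (X' - X) * (A - B * (K + D)) +
      (Dᵀ * (R + Bᵀ * X * B) * D + Dᵀ * gradFactor A B R K X +
        (gradFactor A B R K X)ᵀ * D) = X' - X := by
  -- Eliminating `Q` through the equation for `K` leaves an expression in `D` whose linear terms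
  -- collect into `gradFactor`.
  have hQ : Q = X - (A - B * K)ᵀ * X * (A - B * K) - Kᵀ * R * K := by
    rw [eq_sub_iff_add_eq, eq_sub_iff_add_eq']
    exact h.eq_add
  have h2 : (A - B * (K + D))ᵀ * X' * (A - B * (K + D)) =
      X' - (Q + (K + D)ᵀ * R * (K + D)) := eq_sub_of_add_eq h'.eq_add
  rw [Matrix.mul_sub _ X' X, Matrix.sub_mul _ _ (A - B * (K + D)), h2, hQ]
  simp only [gradFactor, Matrix.transpose_sub, Matrix.transpose_add, Matrix.transpose_mul,
    Matrix.transpose_transpose, hR.eq, hX.eq, Matrix.mul_add, Matrix.add_mul, Matrix.mul_sub,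
    Matrix.sub_mul, Matrix.mul_assoc]
  abel

lemma eq_zero_of_mulVec_span {k : ℕ} {z : Fin n → Fin n → ℝ}
    (hz : Submodule.span ℝ (Set.range z) = ⊤) {M : Matrix (Fin k) (Fin n) ℝ}
    (h : ∀ i, M *ᵥ z i = 0) : M = 0 := by
  have : Matrix.toLin' M = 0 := LinearMap.ext_on_range hz fun i => by simpa using h i
  simpa using this

lemma sum_sq_mulVec_pos {k : ℕ} {z : Fin n → Fin n → ℝ}
    (hz : Submodule.span ℝ (Set.range z) = ⊤) {M : Matrix (Fin k) (Fin n) ℝ} (hM : M ≠ 0) :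
    0 < ∑ i, (M *ᵥ z i) ⬝ᵥ (M *ᵥ z i) := by
  obtain ⟨i, hi⟩ : ∃ i, M *ᵥ z i ≠ 0 := by
    by_contra! hc
    exact hM (eq_zero_of_mulVec_span hz hc)
  refine Finset.sum_pos' (fun i _ => dotProduct_self_nonneg' _) ⟨i, Finset.mem_univ i, ?_⟩
  exact lt_of_le_of_ne (dotProduct_self_nonneg' _) fun h0 => hi (dotProduct_self_eq_zero.1 h0.symm)

/-- For `D = -t G` the weight in the comparison identity is `t² Gᵀ P G - 2 t Gᵀ G`. The quadratic
part is bounded by the locally uniform orbit bound, which gives `C`; `c` comes from the linear part.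
-/
lemma eventually_descent {z : Fin n → Fin n → ℝ} (hz : Submodule.span ℝ (Set.range z) = ⊤)
    (hR : R.IsSymm) {K : Matrix (Fin m) (Fin n) ℝ} (hK : K ∈ stabilizingSet A B)
    {X : Matrix (Fin n) (Fin n) ℝ} (hX : X.IsSymm) (h : SolvesLyapunov A B Q R K X)
    (hG : gradFactor A B R K X ≠ 0) :
    ∃ c > 0, ∃ C : ℝ, ∀ᶠ t in 𝓝 (0 : ℝ),
      K + t • (-gradFactor A B R K X) ∈ stabilizingSet A B ∧
      (0 ≤ t → cost A B Q R z (K + t • (-gradFactor A B R K X)) - cost A B Q R z K ≤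
        C * t ^ 2 - c * t) := by
  set G := gradFactor A B R K X with hGdef
  set P := R + Bᵀ * X * B with hP
  obtain ⟨Y, hY⟩ := eventually_mem_stabilizingSet hK
  refine ⟨2 * ∑ i, (G *ᵥ z i) ⬝ᵥ (G *ᵥ z i), mul_pos two_pos (sum_sq_mulVec_pos hz hG),
    ∑ i, absSum (Gᵀ * P * G) * (2 * (z i ⬝ᵥ (Y *ᵥ z i))), ?_⟩
  have hline : Tendsto (fun t : ℝ => K + t • (-G)) (𝓝 0) (𝓝 K) := by
    have hc : Continuous fun t : ℝ => K + t • (-G) := by fun_prop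
    simpa using hc.tendsto 0
  filter_upwards [hline.eventually hY] with t ht
  obtain ⟨hL, hbd⟩ := ht
  refine ⟨hL, fun ht0 => ?_⟩
  obtain ⟨X', hX', -⟩ := existsUnique_solvesLyapunov (Q := Q) (R := R) hL
  have hW := SolvesLyapunov.sub hR hX h hX'
  rw [← hGdef, ← hP] at hW
  unfold cost
  rw [← Finset.sum_sub_distrib, Finset.mul_sum, Finset.sum_mul, Finset.sum_mul,
    ← Finset.sum_sub_distrib]
  refine Finset.sum_le_sum fun i _ => ?_
  rw [hX'.initialCost_eq hL, h.initialCost_eq hK, ← dotProduct_sub, ← Matrix.sub_mulVec,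
    ← (hasSum_lyapunov hL hW (z i)).tsum_eq]
  set M := A - B * (K + t • (-G)) with hM
  have hs1 := summable_orbit_quadratic hL (Gᵀ * P * G) (z i)
  have hs2 := summable_orbit_quadratic hL (Gᵀ * G) (z i)
  rw [← hM] at hs1 hs2
  have hterm : ∀ x : Fin n → ℝ, x ⬝ᵥ (((t • (-G))ᵀ * P * (t • (-G)) + (t • (-G))ᵀ * G +
      Gᵀ * (t • (-G))) *ᵥ x) =
      t ^ 2 * (x ⬝ᵥ ((Gᵀ * P * G) *ᵥ x)) - 2 * t * (x ⬝ᵥ ((Gᵀ * G) *ᵥ x)) := fun x => by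
    simp only [smul_neg, Matrix.transpose_neg, Matrix.transpose_smul, Matrix.neg_mul,
      Matrix.smul_mul, Matrix.mul_neg, Matrix.mul_smul, neg_neg, Matrix.add_mulVec,
      Matrix.neg_mulVec, Matrix.smul_mulVec, dotProduct_add, dotProduct_neg, dotProduct_smul,
      smul_eq_mul]
    ring
  simp only [hterm]
  rw [(hs1.mul_left (t ^ 2)).tsum_sub (hs2.mul_left (2 * t)), tsum_mul_left, tsum_mul_left]
  have hsq : ∀ x : Fin n → ℝ, x ⬝ᵥ ((Gᵀ * G) *ᵥ x) = (G *ᵥ x) ⬝ᵥ (G *ᵥ x) := fun x => by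
    have := mulVec_dotProduct_mulVec_mulVec G 1 x
    rw [Matrix.one_mulVec, Matrix.mul_one] at this
    exact this.symm
  -- Only the `j = 0` term is kept: it does not depend on `t`, and its sum over `i` is positive
  -- because the `z i` span and `G ≠ 0`.
  have hb2 : (G *ᵥ z i) ⬝ᵥ (G *ᵥ z i) ≤ ∑' j : ℕ, (M ^ j *ᵥ z i) ⬝ᵥ ((Gᵀ * G) *ᵥ (M ^ j *ᵥ z i)) := by
    have := hs2.le_tsum 0 fun j _ => by rw [hsq]; exact dotProduct_self_nonneg' _
    simpa [hsq] using this
  have hb1 : ∑' j : ℕ, (M ^ j *ᵥ z i) ⬝ᵥ ((Gᵀ * P * G) *ᵥ (M ^ j *ᵥ z i)) ≤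
      absSum (Gᵀ * P * G) * (2 * (z i ⬝ᵥ (Y *ᵥ z i))) := by
    have hs := summable_orbit_sq hL (z i)
    calc _ ≤ ∑' j : ℕ, absSum (Gᵀ * P * G) * ((M ^ j *ᵥ z i) ⬝ᵥ (M ^ j *ᵥ z i)) :=
          hs1.tsum_le_tsum (fun j => (abs_le.1 (abs_dotProduct_mulVec_le _ _)).2) (hs.mul_left _)
      _ = _ := tsum_mul_left
      _ ≤ _ := mul_le_mul_of_nonneg_left (hbd (z i)) (absSum_nonneg _)
  have e1 := mul_le_mul_of_nonneg_left hb1 (sq_nonneg t)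
  have e2 := mul_le_mul_of_nonneg_left hb2 (mul_nonneg two_pos.le ht0)
  linarith

/-- The hypothesis `hmin` is a one-sided first-order condition along rays, weak enough to hold both
at local minimizers and at stationary points. Descent along `-G` contradicts it with `ε = c / 2`. -/
lemma gradFactor_eq_zero {z : Fin n → Fin n → ℝ} (hz : Submodule.span ℝ (Set.range z) = ⊤)
    (hR : R.IsSymm) {K : Matrix (Fin m) (Fin n) ℝ} (hK : K ∈ stabilizingSet A B)
    {X : Matrix (Fin n) (Fin n) ℝ} (hX : X.IsSymm) (h : SolvesLyapunov A B Q R K X)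
    (hmin : ∀ D : Matrix (Fin m) (Fin n) ℝ, ∀ ε > 0, ∀ᶠ t in 𝓝[>] (0 : ℝ),
      K + t • D ∈ stabilizingSet A B →
        -(ε * t) ≤ cost A B Q R z (K + t • D) - cost A B Q R z K) :
    gradFactor A B R K X = 0 := by
  by_contra hG
  obtain ⟨c, hc, C, hC⟩ := eventually_descent hz hR hK hX h hG
  have hsmall : ∀ᶠ t in 𝓝 (0 : ℝ), C * t < c / 2 := by
    have : Continuous fun t : ℝ => C * t := by fun_prop
    exact (this.tendsto 0).eventually (gt_mem_nhds (by simpa using half_pos hc))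
  obtain ⟨t, ⟨⟨ht1, ht2⟩, ht3⟩, ht4, ht5⟩ :=
    (((hC.and hsmall).filter_mono nhdsWithin_le_nhds).and
      ((hmin (-gradFactor A B R K X) (c / 2) (half_pos hc)).and self_mem_nhdsWithin)).exists
  have ht0 : 0 < t := ht5
  have h1 := ht2 ht0.le
  have h2 := ht4 ht1
  nlinarith

/-- The value of a gain with vanishing gradient factor differs from that of another stabilizing
gain by a sum of squares with weight `R + Bᵀ X B`. -/
lemma hasSum_initialCost_sub (hR : R.IsSymm) {K L : Matrix (Fin m) (Fin n) ℝ}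
    (hL : L ∈ stabilizingSet A B) {X X' : Matrix (Fin n) (Fin n) ℝ}
    (hX : X.IsSymm) (h : SolvesLyapunov A B Q R K X) (h' : SolvesLyapunov A B Q R L X')
    (hG : gradFactor A B R K X = 0) (x : Fin n → ℝ) :
    HasSum (fun j : ℕ => ((L - K) *ᵥ ((A - B * L) ^ j *ᵥ x)) ⬝ᵥ
      ((R + Bᵀ * X * B) *ᵥ ((L - K) *ᵥ ((A - B * L) ^ j *ᵥ x)))) (x ⬝ᵥ ((X' - X) *ᵥ x)) := by
  have hLK : K + (L - K) = L := by abel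
  have := SolvesLyapunov.sub (D := L - K) hR hX h (by rwa [hLK])
  rw [hLK, hG] at this
  simp only [Matrix.mul_zero, Matrix.transpose_zero, Matrix.zero_mul, add_zero] at this
  simp only [mulVec_dotProduct_mulVec_mulVec (L - K)]
  exact hasSum_lyapunov hL this x

/-- The range `V` of `Δ` lies in `Mᵀ V`, so by dimension `Mᵀ` restricts to a bijection of `V`. Its
injectivity makes `y` a preimage of `x` under `N` modulo `ker Δ`. -/
lemma exists_mulVec_eq_of_fixed {Δ M N : Matrix (Fin n) (Fin n) ℝ} (hfix : Δ = Mᵀ * Δ * N)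
    (x : Fin n → ℝ) : ∃ y : Fin n → ℝ, Δ *ᵥ y = Mᵀ *ᵥ (Δ *ᵥ x) ∧ Δ *ᵥ (N *ᵥ y) = Δ *ᵥ x := by
  set V := LinearMap.range Δ.mulVecLin with hV
  have hfix' : ∀ w, Δ *ᵥ w = Mᵀ *ᵥ (Δ *ᵥ (N *ᵥ w)) := fun w => by
    rw [Matrix.mulVec_mulVec, Matrix.mulVec_mulVec, ← hfix]
  have hmem : ∀ w, Δ *ᵥ w ∈ V := fun w => ⟨w, rfl⟩
  have hle : V ≤ V.map Mᵀ.mulVecLin := by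
    rintro _ ⟨w, rfl⟩
    exact ⟨Δ *ᵥ (N *ᵥ w), hmem _, (hfix' w).symm⟩
  have heq : V = V.map Mᵀ.mulVecLin :=
    Submodule.eq_of_le_of_finrank_le hle (Submodule.finrank_map_le _ _)
  have hmaps : ∀ v ∈ V, Mᵀ.mulVecLin v ∈ V := fun v hv => by
    rw [heq]; exact ⟨v, hv, rfl⟩
  let ψ : V →ₗ[ℝ] V := Mᵀ.mulVecLin.restrict hmaps
  have hsurj : Function.Surjective ψ := by
    rintro ⟨v, hv⟩
    rw [heq] at hv
    obtain ⟨u, hu, rfl⟩ := hv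
    exact ⟨⟨u, hu⟩, rfl⟩
  have hinj := LinearMap.injective_iff_surjective.2 hsurj
  obtain ⟨y, hy⟩ : Mᵀ.mulVecLin (Δ *ᵥ x) ∈ V := hmaps _ (hmem x)
  have hy' : Δ *ᵥ y = Mᵀ *ᵥ (Δ *ᵥ x) := hy
  refine ⟨y, hy', ?_⟩
  have : (⟨Δ *ᵥ (N *ᵥ y), hmem _⟩ : V) = ⟨Δ *ᵥ x, hmem _⟩ :=
    hinj (Subtype.ext ((hfix' y).symm.trans hy'))
  exact congrArg Subtype.val this

/-- If `Δ = Mᵀ Δ N` with `M` Schur stable and the quadratic form of `Δ` does not decrease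
along `N`, then it is nonnegative. -/
lemma nonneg_of_fixed_of_nondecreasing {Δ M N : Matrix (Fin n) (Fin n) ℝ} (hM : specRadius M < 1)
    (hsymm : Δ.IsSymm) (hfix : Δ = Mᵀ * Δ * N)
    (hinc : ∀ x, x ⬝ᵥ (Δ *ᵥ x) ≤ (N *ᵥ x) ⬝ᵥ (Δ *ᵥ (N *ᵥ x))) (x : Fin n → ℝ) :
    0 ≤ x ⬝ᵥ (Δ *ᵥ x) := by
  have hswap : ∀ u v : Fin n → ℝ, u ⬝ᵥ (Δ *ᵥ v) = (Δ *ᵥ u) ⬝ᵥ v := fun u v => by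
    rw [Matrix.dotProduct_mulVec, ← Matrix.mulVec_transpose, hsymm.eq]
  -- `g` inverts `N` modulo `ker Δ`. The form depends only on `Δ *ᵥ u`, so it does not increase
  -- along `g`.
  choose g hg1 hg2 using exists_mulVec_eq_of_fixed hfix
  have hdec : ∀ u, (g u) ⬝ᵥ (Δ *ᵥ (g u)) ≤ u ⬝ᵥ (Δ *ᵥ u) := fun u => by
    refine (hinc (g u)).trans_eq ?_
    rw [hg2, hswap, hg2, ← hswap]
  have hiter : ∀ j : ℕ, (g^[j] x) ⬝ᵥ (Δ *ᵥ (g^[j] x)) ≤ x ⬝ᵥ (Δ *ᵥ x) ∧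
      Δ *ᵥ (g^[j] x) = (M ^ j)ᵀ *ᵥ (Δ *ᵥ x) := by
    intro j
    induction j with
    | zero => simp
    | succ k ih =>
      rw [Function.iterate_succ_apply']
      refine ⟨(hdec _).trans ih.1, ?_⟩
      rw [hg1, ih.2, Matrix.mulVec_mulVec, ← Matrix.transpose_mul, pow_succ]
  -- The iterates of `g` need not converge; only their images under `Δ` tend to zero. A linear
  -- section `H` of `Δ` on its range writes the form as a continuous function of `Δ *ᵥ u` alone.
  obtain ⟨s, hs⟩ := Δ.mulVecLin.rangeRestrict.exists_rightInverse_of_surjective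
    (LinearMap.range_rangeRestrict _)
  obtain ⟨H, hH⟩ := s.exists_extend
  have hgen : ∀ u, Δ *ᵥ (H (Δ *ᵥ u)) = Δ *ᵥ u := fun u => by
    have h1 : H (Δ *ᵥ u) = s ⟨Δ *ᵥ u, u, rfl⟩ := LinearMap.congr_fun hH ⟨Δ *ᵥ u, u, rfl⟩
    rw [h1]
    exact congrArg Subtype.val (LinearMap.congr_fun hs ⟨Δ *ᵥ u, u, rfl⟩)
  have hquad : ∀ u, u ⬝ᵥ (Δ *ᵥ u) = (Δ *ᵥ u) ⬝ᵥ H (Δ *ᵥ u) := fun u => by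
    rw [← hswap, hgen]
  have hlim : Tendsto (fun j : ℕ => (M ^ j)ᵀ *ᵥ (Δ *ᵥ x)) atTop (𝓝 0) := by
    have hc : Continuous fun W : Matrix (Fin n) (Fin n) ℝ => Wᵀ *ᵥ (Δ *ᵥ x) := by fun_prop
    simpa [Function.comp_def] using (hc.tendsto 0).comp (tendsto_pow_of_specRadius_lt_one hM)
  have hcH : Continuous fun v : Fin n → ℝ => v ⬝ᵥ H v := by
    have := H.continuous_of_finiteDimensional
    fun_prop
  have hlim2 := (hcH.tendsto 0).comp hlim
  simp only [zero_dotProduct] at hlim2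
  refine le_of_tendsto' hlim2 fun j => ?_
  have := (hiter j).1
  rw [hquad, (hiter j).2] at this
  exact this

/-- The feedback gain attached to a solution of the Riccati equation. -/
noncomputable def dareGain (A : Matrix (Fin n) (Fin n) ℝ) (B : Matrix (Fin n) (Fin m) ℝ)
    (R : Matrix (Fin m) (Fin m) ℝ) (X : Matrix (Fin n) (Fin n) ℝ) : Matrix (Fin m) (Fin n) ℝ :=
  (R + Bᵀ * X * B)⁻¹ * Bᵀ * X * A

/-! ### Riccati solutions as zeros of the gradient factor -/

lemma gradFactor_dareGain {X : Matrix (Fin n) (Fin n) ℝ} (h : IsUnit (R + Bᵀ * X * B)) :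
    gradFactor A B R (dareGain A B R X) X = 0 := by
  have hdet := (Matrix.isUnit_iff_isUnit_det _).1 h
  rw [gradFactor, dareGain, sub_eq_zero]
  simp only [Matrix.mul_assoc]
  rw [Matrix.mul_nonsing_inv_cancel_left]
  simpa only [Matrix.mul_assoc] using hdet

lemma eq_dareGain {K : Matrix (Fin m) (Fin n) ℝ} {X : Matrix (Fin n) (Fin n) ℝ}
    (h : IsUnit (R + Bᵀ * X * B)) (hG : gradFactor A B R K X = 0) : K = dareGain A B R X := by
  have hdet := (Matrix.isUnit_iff_isUnit_det _).1 h
  have h1 : (R + Bᵀ * X * B) * K = Bᵀ * X * A := sub_eq_zero.1 hG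
  have h2 := congrArg ((R + Bᵀ * X * B)⁻¹ * ·) h1
  simp only [Matrix.nonsing_inv_mul_cancel_left _ _ hdet] at h2
  rw [h2, dareGain]
  simp only [Matrix.mul_assoc]

/-- Vanishing of the gradient factor in terms of the closed-loop matrix. -/
lemma mul_eq_of_gradFactor_eq_zero {K : Matrix (Fin m) (Fin n) ℝ} {X : Matrix (Fin n) (Fin n) ℝ}
    (hG : gradFactor A B R K X = 0) : Bᵀ * X * (A - B * K) = R * K := by
  have h1 : (R + Bᵀ * X * B) * K = Bᵀ * X * A := sub_eq_zero.1 hG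
  rw [Matrix.mul_sub, ← h1]
  simp only [Matrix.add_mul, Matrix.mul_assoc]
  abel

lemma SolvesDARE.eq_add {X : Matrix (Fin n) (Fin n) ℝ} (h : SolvesDARE A B Q R X) :
    Aᵀ * X * (A - B * dareGain A B R X) + Q = X := by
  conv_rhs => rw [h.2]
  rw [Matrix.mul_sub, dareGain]
  simp only [Matrix.mul_assoc]
  abel

lemma SolvesDARE.solvesLyapunov {X : Matrix (Fin n) (Fin n) ℝ} (h : SolvesDARE A B Q R X) :
    SolvesLyapunov A B Q R (dareGain A B R X) X := by
  have h1 := mul_eq_of_gradFactor_eq_zero (gradFactor_dareGain (A := A) h.1)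
  have h2 := h.eq_add
  set K := dareGain A B R X
  unfold SolvesLyapunov
  conv_rhs => rw [← h2]
  have : (A - B * K)ᵀ * X * (A - B * K) =
      Aᵀ * X * (A - B * K) - Kᵀ * (Bᵀ * X * (A - B * K)) := by
    rw [Matrix.transpose_sub, Matrix.transpose_mul, Matrix.sub_mul, Matrix.sub_mul _ _ (A - B * K)]
    simp only [Matrix.mul_assoc]
  rw [this, h1]
  simp only [Matrix.mul_assoc]
  abel

lemma SolvesLyapunov.eq_add_of_gradFactor_eq_zero {K : Matrix (Fin m) (Fin n) ℝ}
    {X : Matrix (Fin n) (Fin n) ℝ} (h : SolvesLyapunov A B Q R K X)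
    (hG : gradFactor A B R K X = 0) : Aᵀ * X * (A - B * K) + Q = X := by
  have h1 := mul_eq_of_gradFactor_eq_zero hG
  have : (A - B * K)ᵀ * X * (A - B * K) =
      Aᵀ * X * (A - B * K) - Kᵀ * (Bᵀ * X * (A - B * K)) := by
    rw [Matrix.transpose_sub, Matrix.transpose_mul, Matrix.sub_mul, Matrix.sub_mul _ _ (A - B * K)]
    simp only [Matrix.mul_assoc]
  have h2 := h.eq_add
  rw [this, h1] at h2
  conv_rhs => rw [← h2]
  simp only [Matrix.mul_assoc]
  abel

lemma SolvesLyapunov.solvesDARE {K : Matrix (Fin m) (Fin n) ℝ}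
    {X : Matrix (Fin n) (Fin n) ℝ} (h : SolvesLyapunov A B Q R K X)
    (hG : gradFactor A B R K X = 0) (hU : IsUnit (R + Bᵀ * X * B)) : SolvesDARE A B Q R X := by
  refine ⟨hU, ?_⟩
  have h1 := h.eq_add_of_gradFactor_eq_zero hG
  conv_lhs => rw [← h1, eq_dareGain hU hG]
  rw [Matrix.mul_sub, dareGain]
  simp only [Matrix.mul_assoc]
  abel

/-- The difference of a symmetric solution `Xs` and any solution `X` of the Riccati equation
is fixed by the Sylvester operator of the two closed-loop matrices. -/
lemma dare_sub_eq (hQ : Q.IsSymm) (hR : R.IsSymm) {K K' : Matrix (Fin m) (Fin n) ℝ}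
    {Xs X : Matrix (Fin n) (Fin n) ℝ} (hXs : Xs.IsSymm)
    (h1 : Aᵀ * Xs * (A - B * K) + Q = Xs) (h2 : Bᵀ * Xs * (A - B * K) = R * K)
    (h3 : Aᵀ * X * (A - B * K') + Q = X) (h4 : Bᵀ * X * (A - B * K') = R * K') :
    Xs - X = (A - B * K)ᵀ * (Xs - X) * (A - B * K') := by
  -- Only the equations of `Xs` are transposed, so `X` need not be symmetric, as uniqueness among
  -- all almost stabilizing solutions requires.
  have h1' : (A - B * K)ᵀ * Xs * A + Q = Xs := by
    have := congrArg Matrix.transpose h1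
    rwa [Matrix.transpose_add, Matrix.transpose_mul, Matrix.transpose_mul, hQ.eq, hXs.eq,
      Matrix.transpose_transpose, ← Matrix.mul_assoc] at this
  have h2' : (A - B * K)ᵀ * Xs * B = Kᵀ * R := by
    have := congrArg Matrix.transpose h2
    rwa [Matrix.transpose_mul, Matrix.transpose_mul, Matrix.transpose_mul, hR.eq, hXs.eq,
      Matrix.transpose_transpose, ← Matrix.mul_assoc] at this
  have e1 : (A - B * K)ᵀ * Xs * (A - B * K') = Xs - Q - Kᵀ * R * K' := by
    rw [Matrix.mul_sub, ← Matrix.mul_assoc _ B K', h2', eq_sub_of_add_eq h1']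
  have e2 : (A - B * K)ᵀ * X * (A - B * K') = X - Q - Kᵀ * R * K' := by
    rw [Matrix.transpose_sub, Matrix.transpose_mul, Matrix.sub_mul, Matrix.sub_mul _ _ (A - B * K'),
      Matrix.mul_assoc Kᵀ, Matrix.mul_assoc Kᵀ, h4, eq_sub_of_add_eq h3, Matrix.mul_assoc Kᵀ]
  rw [Matrix.mul_sub _ Xs X, Matrix.sub_mul _ _ (A - B * K'), e1, e2]
  abel

lemma continuous_frobNorm_sub (K : Matrix (Fin m) (Fin n) ℝ) :
    Continuous fun L : Matrix (Fin m) (Fin n) ℝ => frobNorm (L - K) := by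
  unfold frobNorm
  fun_prop

lemma IsStrictLocalMinimizer.eventually_lt {f : Matrix (Fin m) (Fin n) ℝ → ℝ}
    {S : Set (Matrix (Fin m) (Fin n) ℝ)} {K : Matrix (Fin m) (Fin n) ℝ}
    (h : IsStrictLocalMinimizer f S K) : ∀ᶠ L in 𝓝 K, L ∈ S → L ≠ K → f K < f L := by
  obtain ⟨-, δ, hδ, hmin⟩ := h
  have h0 : frobNorm (K - K) < δ := by simpa [frobNorm] using hδ
  filter_upwards [((continuous_frobNorm_sub K).tendsto K).eventually (gt_mem_nhds h0)] with L hL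
    hS hne using hmin L hS hne hL

lemma tendsto_add_smul (K D : Matrix (Fin m) (Fin n) ℝ) :
    Tendsto (fun t : ℝ => K + t • D) (𝓝 0) (𝓝 K) := by
  have hc : Continuous fun t : ℝ => K + t • D := by fun_prop
  simpa using hc.tendsto 0

lemma cost_sub_eq {z : Fin n → Fin n → ℝ} {K L : Matrix (Fin m) (Fin n) ℝ}
    (hK : K ∈ stabilizingSet A B) (hL : L ∈ stabilizingSet A B)
    {X X' : Matrix (Fin n) (Fin n) ℝ} (h : SolvesLyapunov A B Q R K X)
    (h' : SolvesLyapunov A B Q R L X') :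
    cost A B Q R z L - cost A B Q R z K = ∑ i, z i ⬝ᵥ ((X' - X) *ᵥ z i) := by
  unfold cost
  rw [← Finset.sum_sub_distrib]
  refine Finset.sum_congr rfl fun i _ => ?_
  rw [h'.initialCost_eq hL, h.initialCost_eq hK, Matrix.sub_mulVec, dotProduct_sub]

/-! ### Stationary points and the derivative of the cost -/

section Derivative

attribute [local instance] Matrix.normedAddCommGroup Matrix.normedSpace

lemma IsStationaryPoint.eventually_line {f : Matrix (Fin m) (Fin n) ℝ → ℝ}
    {K : Matrix (Fin m) (Fin n) ℝ} (h : IsStationaryPoint f K) (D : Matrix (Fin m) (Fin n) ℝ)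
    {ε : ℝ} (hε : 0 < ε) : ∀ᶠ t in 𝓝[>] (0 : ℝ), -(ε * t) ≤ f (K + t • D) - f K := by
  -- The derivative depends only on the topology, so it may be read in the entrywise sup norm.
  have h' : HasFDerivAt f (0 : Matrix (Fin m) (Fin n) ℝ →L[ℝ] ℝ) K := h
  have h1 := hasLineDerivAt_iff_isLittleO_nhds_zero.1 (h'.hasLineDerivAt D)
  filter_upwards [nhdsWithin_le_nhds (h1.def hε), self_mem_nhdsWithin] with t ht ht0
  have ht0' : 0 < t := ht0
  simp only [Real.norm_eq_abs, abs_of_pos ht0'] at ht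
  have h2 : -(ε * t) ≤ f (K + t • D) - f K - t • (0 : ℝ) := (abs_le.1 ht).1
  rwa [smul_zero, sub_zero] at h2

lemma absSum_transpose_mul_mul_le (P : Matrix (Fin m) (Fin m) ℝ) (D : Matrix (Fin m) (Fin n) ℝ) :
    absSum (Dᵀ * P * D) ≤ (∑ _i : Fin n, ∑ _j : Fin n, absSum P) * ‖D‖ ^ 2 := by
  unfold absSum
  simp only [Finset.sum_mul]
  refine Finset.sum_le_sum fun i _ => Finset.sum_le_sum fun j _ => ?_
  simp only [Matrix.mul_apply, Matrix.transpose_apply, Finset.sum_mul]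
  rw [Finset.sum_comm]
  refine (Finset.abs_sum_le_sum_abs _ _).trans (Finset.sum_le_sum fun k _ => ?_)
  refine (Finset.abs_sum_le_sum_abs _ _).trans (Finset.sum_le_sum fun l _ => ?_)
  rw [abs_mul, abs_mul]
  have h1 : |D k i| ≤ ‖D‖ := Matrix.norm_entry_le_entrywise_sup_norm D
  have h2 : |D l j| ≤ ‖D‖ := Matrix.norm_entry_le_entrywise_sup_norm D
  calc |D k i| * |P k l| * |D l j| ≤ ‖D‖ * |P k l| * ‖D‖ := by gcongr
    _ = _ := by ring

/-- With `G = 0` the cost difference has weight `(L - K)ᵀ P (L - K)`. The locally uniform orbit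
bound makes it `O(‖L - K‖²)`, which gives differentiability and the zero derivative at once. -/
lemma isStationaryPoint_of_gradFactor_eq_zero {z : Fin n → Fin n → ℝ} (hR : R.IsSymm)
    {K : Matrix (Fin m) (Fin n) ℝ} (hK : K ∈ stabilizingSet A B)
    {X : Matrix (Fin n) (Fin n) ℝ} (hX : X.IsSymm) (h : SolvesLyapunov A B Q R K X)
    (hG : gradFactor A B R K X = 0) : IsStationaryPoint (cost A B Q R z) K := by
  set P := R + Bᵀ * X * B with hP
  obtain ⟨Y, hY⟩ := eventually_mem_stabilizingSet hK
  have hbound : ∀ᶠ L in 𝓝 K, ‖cost A B Q R z L - cost A B Q R z K‖ ≤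
      ((∑ _i : Fin n, ∑ _j : Fin n, absSum P) * |∑ i, 2 * (z i ⬝ᵥ (Y *ᵥ z i))|) *
        ‖‖L - K‖ ^ 2‖ := by
    filter_upwards [hY] with L hL
    obtain ⟨hL, hbd⟩ := hL
    obtain ⟨X', hX', -⟩ := existsUnique_solvesLyapunov (Q := Q) (R := R) hL
    rw [cost_sub_eq hK hL h hX']
    have hi : ∀ i, |z i ⬝ᵥ ((X' - X) *ᵥ z i)| ≤
        absSum ((L - K)ᵀ * P * (L - K)) * (2 * (z i ⬝ᵥ (Y *ᵥ z i))) := fun i => by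
      have hs := hasSum_initialCost_sub hR hL hX h hX' hG (z i)
      simp only [mulVec_dotProduct_mulVec_mulVec (L - K)] at hs
      have hsq := (summable_orbit_sq hL (z i)).mul_left (absSum ((L - K)ᵀ * P * (L - K)))
      have := tsum_of_norm_bounded (f := fun j : ℕ => ((A - B * L) ^ j *ᵥ z i) ⬝ᵥ
        (((L - K)ᵀ * P * (L - K)) *ᵥ ((A - B * L) ^ j *ᵥ z i))) hsq.hasSum fun j =>
        abs_dotProduct_mulVec_le ((L - K)ᵀ * P * (L - K)) ((A - B * L) ^ j *ᵥ z i)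
      rw [← hs.tsum_eq]
      refine this.trans ?_
      rw [tsum_mul_left]
      exact mul_le_mul_of_nonneg_left (hbd (z i)) (absSum_nonneg _)
    calc ‖∑ i, z i ⬝ᵥ ((X' - X) *ᵥ z i)‖
        ≤ ∑ i, absSum ((L - K)ᵀ * P * (L - K)) * (2 * (z i ⬝ᵥ (Y *ᵥ z i))) :=
          (norm_sum_le _ _).trans (Finset.sum_le_sum fun i _ => hi i)
      _ ≤ absSum ((L - K)ᵀ * P * (L - K)) * |∑ i, 2 * (z i ⬝ᵥ (Y *ᵥ z i))| := by
          rw [← Finset.mul_sum]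
          exact mul_le_mul_of_nonneg_left (le_abs_self _) (absSum_nonneg _)
      _ ≤ ((∑ _i : Fin n, ∑ _j : Fin n, absSum P) * ‖L - K‖ ^ 2) *
            |∑ i, 2 * (z i ⬝ᵥ (Y *ᵥ z i))| :=
          mul_le_mul_of_nonneg_right (absSum_transpose_mul_mul_le _ _) (abs_nonneg _)
      _ = _ := by rw [norm_pow, norm_norm]; ring
  have hO : (fun L => cost A B Q R z L - cost A B Q R z K) =O[𝓝 K] fun L => ‖L - K‖ ^ 2 :=
    Asymptotics.IsBigO.of_bound _ hbound
  have ho : (fun L : Matrix (Fin m) (Fin n) ℝ => ‖L - K‖ ^ 2) =o[𝓝 K] fun L => L - K := by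
    refine Asymptotics.IsLittleO.of_norm_right ?_
    simp only [sq]
    have h0 : Tendsto (fun L : Matrix (Fin m) (Fin n) ℝ => ‖L - K‖) (𝓝 K) (𝓝 0) := by
      have hc : Continuous fun L : Matrix (Fin m) (Fin n) ℝ => ‖L - K‖ := by fun_prop
      simpa using hc.tendsto K
    simpa using ((Asymptotics.isLittleO_one_iff ℝ).2 h0).mul_isBigO
      (Asymptotics.isBigO_refl (fun L : Matrix (Fin m) (Fin n) ℝ => ‖L - K‖) (𝓝 K))
  have h1 : HasFDerivAt (cost A B Q R z) (0 : Matrix (Fin m) (Fin n) ℝ →L[ℝ] ℝ) K := by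
    refine HasFDerivAt.of_isLittleO ?_
    exact (hO.trans_isLittleO ho).congr_left fun L => (sub_zero _).symm
  exact h1

end Derivative

/-! ### Positive definite weight and its global consequences -/

lemma posDef_of_quadratic_pos {k : ℕ} {P : Matrix (Fin k) (Fin k) ℝ} (hP : P.IsSymm)
    (h : ∀ u, u ≠ 0 → 0 < u ⬝ᵥ (P *ᵥ u)) : P.PosDef :=
  Matrix.PosDef.of_dotProduct_mulVec_pos
    (by rw [Matrix.IsHermitian, Matrix.conjTranspose_eq_transpose_of_trivial]; exact hP)
    fun u hu => by simpa using h u hu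

lemma isSymm_weight (hR : R.IsSymm) {X : Matrix (Fin n) (Fin n) ℝ} (hX : X.IsSymm) :
    (R + Bᵀ * X * B).IsSymm := by
  simp [Matrix.IsSymm, Matrix.mul_assoc, hR.eq, hX.eq]

/-- A rank-one perturbation `t u wᵀ` sends every state to a multiple of `u`, so each term of the
cost difference is a square times `u ⬝ᵥ P u`. If that number were nonpositive, gains arbitrarily
near `K` would cost no more, against strictness. A nonzero `w` exists because `0 < n`. -/
lemma weight_posDef_of_isStrictLocalMinimizer (hn : 0 < n) {z : Fin n → Fin n → ℝ}
    (hR : R.IsSymm) {K : Matrix (Fin m) (Fin n) ℝ}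
    (hmin : IsStrictLocalMinimizer (cost A B Q R z) (stabilizingSet A B) K)
    {X : Matrix (Fin n) (Fin n) ℝ} (hX : X.IsSymm) (h : SolvesLyapunov A B Q R K X)
    (hG : gradFactor A B R K X = 0) : (R + Bᵀ * X * B).PosDef := by
  refine posDef_of_quadratic_pos (isSymm_weight hR hX) fun u hu => ?_
  by_contra! hneg
  have hK := hmin.1
  set w : Fin n → ℝ := Pi.single ⟨0, hn⟩ 1 with hw
  have hD : vecMulVec u w ≠ 0 := fun h0 => hu <| funext fun i => by
    simpa [hw, vecMulVec_apply] using congrFun (congrFun h0 i) ⟨0, hn⟩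
  obtain ⟨Y, hY⟩ := eventually_mem_stabilizingSet hK
  obtain ⟨t, ⟨hlt, hL, -⟩, ht⟩ :=
    ((((tendsto_add_smul K (vecMulVec u w)).eventually
      (hmin.eventually_lt.and hY)).filter_mono nhdsWithin_le_nhds).and
      (self_mem_nhdsWithin (s := Set.Ioi (0 : ℝ)))).exists
  have ht0 : t ≠ 0 := ne_of_gt ht
  have hlt' := hlt hL (by simpa [ht0] using hD)
  obtain ⟨X', hX', -⟩ := existsUnique_solvesLyapunov (Q := Q) (R := R) hL
  have hsub := cost_sub_eq (z := z) hK hL h hX'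
  have hle : ∑ i, z i ⬝ᵥ ((X' - X) *ᵥ z i) ≤ 0 := by
    refine Finset.sum_nonpos fun i _ => ?_
    refine (hasSum_initialCost_sub hR hL hX h hX' hG (z i)).nonpos fun j => ?_
    rw [add_sub_cancel_left, Matrix.smul_mulVec, Matrix.vecMulVec_mulVec]
    simp only [op_smul_eq_smul, Matrix.mulVec_smul, smul_dotProduct, dotProduct_smul, smul_eq_mul]
    generalize w ⬝ᵥ _ = a
    have := mul_nonneg (mul_self_nonneg (t * a)) (neg_nonneg.2 hneg)
    nlinarith
  linarith

/-- A gain whose gradient factor vanishes and whose weight matrix is positive definite beats every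
other stabilizing gain, state by state. -/
lemma value_sub_nonneg (hR : R.IsSymm) {K L : Matrix (Fin m) (Fin n) ℝ}
    (hL : L ∈ stabilizingSet A B) {X X' : Matrix (Fin n) (Fin n) ℝ}
    (hX : X.IsSymm) (h : SolvesLyapunov A B Q R K X) (h' : SolvesLyapunov A B Q R L X')
    (hG : gradFactor A B R K X = 0) (hP : (R + Bᵀ * X * B).PosDef) (x : Fin n → ℝ) :
    0 ≤ x ⬝ᵥ ((X' - X) *ᵥ x) ∧ (x ⬝ᵥ ((X' - X) *ᵥ x) ≤ 0 → (L - K) *ᵥ x = 0) := by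
  have hs := hasSum_initialCost_sub hR hL hX h h' hG x
  have hnn : ∀ v, 0 ≤ v ⬝ᵥ ((R + Bᵀ * X * B) *ᵥ v) := fun v => by
    simpa using hP.posSemidef.dotProduct_mulVec_nonneg v
  refine ⟨hs.nonneg fun j => hnn _, fun hle => ?_⟩
  by_contra hne
  have h0 := le_hasSum hs 0 fun j _ => hnn _
  have h1 := hP.dotProduct_mulVec_pos hne
  simp only [pow_zero, Matrix.one_mulVec] at h0
  simp only [star_trivial] at h1
  linarith

lemma cost_lt_of_ne {z : Fin n → Fin n → ℝ} (hz : Submodule.span ℝ (Set.range z) = ⊤)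
    (hR : R.IsSymm) {K L : Matrix (Fin m) (Fin n) ℝ} (hK : K ∈ stabilizingSet A B)
    (hL : L ∈ stabilizingSet A B) {X : Matrix (Fin n) (Fin n) ℝ}
    (hX : X.IsSymm) (h : SolvesLyapunov A B Q R K X)
    (hG : gradFactor A B R K X = 0) (hP : (R + Bᵀ * X * B).PosDef) (hne : L ≠ K) :
    cost A B Q R z K < cost A B Q R z L := by
  obtain ⟨X', hX', -⟩ := existsUnique_solvesLyapunov (Q := Q) (R := R) hL
  have hv := fun i => value_sub_nonneg hR hL hX h hX' hG hP (z i)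
  have hsub := cost_sub_eq (z := z) hK hL h hX'
  obtain ⟨i, hi⟩ : ∃ i, (L - K) *ᵥ z i ≠ 0 := by
    by_contra! hc
    exact hne (sub_eq_zero.1 (eq_zero_of_mulVec_span hz hc))
  have : 0 < ∑ i, z i ⬝ᵥ ((X' - X) *ᵥ z i) :=
    Finset.sum_pos' (fun i _ => (hv i).1)
      ⟨i, Finset.mem_univ i, not_le.1 fun hle => hi ((hv i).2 hle)⟩
  linarith

/-- Among stabilizing gains, the gradient factor vanishes at most once if the weight is
positive definite at one such gain. -/
lemma eq_of_gradFactor_eq_zero (hR : R.IsSymm) {K L : Matrix (Fin m) (Fin n) ℝ}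
    (hK : K ∈ stabilizingSet A B) (hL : L ∈ stabilizingSet A B)
    {X X' : Matrix (Fin n) (Fin n) ℝ} (hX : X.IsSymm) (hXs' : X'.IsSymm)
    (h : SolvesLyapunov A B Q R K X) (h' : SolvesLyapunov A B Q R L X')
    (hG : gradFactor A B R K X = 0) (hG' : gradFactor A B R L X' = 0)
    (hP : (R + Bᵀ * X * B).PosDef) : L = K := by
  have hv := value_sub_nonneg hR hL hX h h' hG hP
  -- Since `X' - X` has a nonnegative form, the weight at `L` dominates the weight at `K`. The roles
  -- can then be exchanged, and the two gains have equal value at every state.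
  have hP' : (R + Bᵀ * X' * B).PosDef := by
    refine posDef_of_quadratic_pos (isSymm_weight hR hXs') fun u hu => ?_
    have h1 := hP.dotProduct_mulVec_pos hu
    have h2 := (hv (B *ᵥ u)).1
    rw [mulVec_dotProduct_mulVec_mulVec, Matrix.mul_sub, Matrix.sub_mul, Matrix.sub_mulVec,
      dotProduct_sub] at h2
    simp only [star_trivial, Matrix.add_mulVec, dotProduct_add] at h1 ⊢
    linarith
  have hv' := value_sub_nonneg hR hK hXs' h' h hG' hP'
  refine sub_eq_zero.1 (Matrix.ext_of_mulVec_single fun i => ?_)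
  rw [Matrix.zero_mulVec]
  refine (hv _).2 ?_
  have := (hv' (Pi.single i 1)).1
  rw [← neg_sub, Matrix.neg_mulVec, dotProduct_neg] at this
  linarith

/-- A symmetric stabilizing solution with positive definite weight dominates every
symmetric solution of the Riccati equation. -/
lemma dare_sub_posSemidef (hQ : Q.IsSymm) (hR : R.IsSymm) {K : Matrix (Fin m) (Fin n) ℝ}
    (hK : K ∈ stabilizingSet A B) {Xs : Matrix (Fin n) (Fin n) ℝ} (hXs : Xs.IsSymm)
    (h : SolvesLyapunov A B Q R K Xs) (hG : gradFactor A B R K Xs = 0)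
    (hP : (R + Bᵀ * Xs * B).PosDef) {X : Matrix (Fin n) (Fin n) ℝ} (hX : X.IsSymm)
    (hD : SolvesDARE A B Q R X) : (Xs - X).PosSemidef := by
  set P := R + Bᵀ * Xs * B
  have hsymm : (Xs - X).IsSymm := hXs.sub hX
  have hfix := dare_sub_eq hQ hR hXs (h.eq_add_of_gradFactor_eq_zero hG)
    (mul_eq_of_gradFactor_eq_zero hG) hD.eq_add
    (mul_eq_of_gradFactor_eq_zero (gradFactor_dareGain hD.1))
  refine Matrix.PosSemidef.of_dotProduct_mulVec_nonneg
    (by rw [Matrix.IsHermitian, Matrix.conjTranspose_eq_transpose_of_trivial]; exact hsymm)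
    fun x => ?_
  rw [star_trivial]
  refine nonneg_of_fixed_of_nondecreasing hK hsymm hfix (fun y => ?_) x
  set L := dareGain A B R X
  have hLK : K + (L - K) = L := by abel
  -- The comparison identity is purely algebraic, so `L` need not be stabilizing. Its square term
  -- shows that the form of `Xs - X` does not decrease along `A - B * L`.
  have hsub := SolvesLyapunov.sub (D := L - K) hR hXs h (by rw [hLK]; exact hD.solvesLyapunov)
  rw [hLK, hG] at hsub
  change _ + ((L - K)ᵀ * P * (L - K) + _ + _) = _ at hsub
  simp only [Matrix.mul_zero, Matrix.transpose_zero, Matrix.zero_mul, add_zero] at hsub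
  have h1 := congrArg (fun W => y ⬝ᵥ (W *ᵥ y)) hsub
  simp only [Matrix.add_mulVec, dotProduct_add, ← mulVec_dotProduct_mulVec_mulVec] at h1
  have h2 := hP.posSemidef.dotProduct_mulVec_nonneg ((L - K) *ᵥ y)
  rw [star_trivial] at h2
  rw [← neg_sub X Xs]
  simp only [Matrix.neg_mulVec, dotProduct_neg]
  linarith

end LinearQuadratic

end IndefiniteLQ

theorem mainTheorem4 (n m : ℕ) (hn : 0 < n)
    (A : Matrix (Fin n) (Fin n) ℝ) (B : Matrix (Fin n) (Fin m) ℝ)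
    (Q : Matrix (Fin n) (Fin n) ℝ) (R : Matrix (Fin m) (Fin m) ℝ)
    (hQ : Q.IsSymm) (hR : R.IsSymm)
    (z : Fin n → Fin n → ℝ) (hz : Submodule.span ℝ (Set.range z) = ⊤)
    (Ks : Matrix (Fin m) (Fin n) ℝ)
    (hKs : IndefiniteLQ.IsStrictLocalMinimizer (IndefiniteLQ.cost A B Q R z)
      (IndefiniteLQ.stabilizingSet A B) Ks) :
    ∃ Xs : Matrix (Fin n) (Fin n) ℝ,
      (∀ X, IndefiniteLQ.SolvesLyapunov A B Q R Ks X ↔ X = Xs) ∧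
      Xs.IsSymm ∧
      (R + Bᵀ * Xs * B).PosDef ∧
      IndefiniteLQ.SolvesDARE A B Q R Xs ∧
      (∀ K, (K ∈ IndefiniteLQ.stabilizingSet A B ∧
          IsMinOn (IndefiniteLQ.cost A B Q R z) (IndefiniteLQ.stabilizingSet A B) K) ↔ K = Ks) ∧
      (∀ K, (K ∈ IndefiniteLQ.stabilizingSet A B ∧
          IndefiniteLQ.IsStationaryPoint (IndefiniteLQ.cost A B Q R z) K) ↔ K = Ks) ∧
      IndefiniteLQ.IsMaximalDARESolution A B Q R Xs ∧
      (∀ X, IndefiniteLQ.IsAlmostStabilizingDARESolution A B Q R X ↔ X = Xs) := by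
  open IndefiniteLQ Filter Topology in
  have hK : Ks ∈ stabilizingSet A B := hKs.1
  obtain ⟨Xs, hL, huniq⟩ := existsUnique_solvesLyapunov (Q := Q) (R := R) hK
  have hsymm : Xs.IsSymm := hL.isSymm hQ hR hK
  have hG : gradFactor A B R Ks Xs = 0 := by
    refine gradFactor_eq_zero hz hR hK hsymm hL fun D ε hε => ?_
    filter_upwards [nhdsWithin_le_nhds ((tendsto_add_smul Ks D).eventually hKs.eventually_lt),
      self_mem_nhdsWithin] with t ht ht0 hS
    have ht0' : 0 < t := ht0
    have hεt : 0 < ε * t := mul_pos hε ht0'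
    -- The direction `D` may be zero, where the strict inequality is unavailable.
    by_cases hne : Ks + t • D = Ks
    · rw [hne]; linarith
    · linarith [ht hS hne]
  have hP : (R + Bᵀ * Xs * B).PosDef :=
    weight_posDef_of_isStrictLocalMinimizer hn hR hKs hsymm hL hG
  have hDARE : SolvesDARE A B Q R Xs := hL.solvesDARE hG hP.isUnit
  have hlt : ∀ K ∈ stabilizingSet A B, K ≠ Ks → cost A B Q R z Ks < cost A B Q R z K :=
    fun K hKS hne => cost_lt_of_ne hz hR hK hKS hsymm hL hG hP hne
  refine ⟨Xs, fun X => ⟨huniq X, fun h => h ▸ hL⟩, hsymm, hP, hDARE, fun K => ⟨fun h => ?_, ?_⟩,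
    fun K => ⟨fun h => ?_, ?_⟩, ⟨hsymm, hDARE, fun X hX hD =>
      dare_sub_posSemidef hQ hR hK hsymm hL hG hP hX hD⟩, fun X => ⟨fun h => ?_, ?_⟩⟩
  · by_contra hne
    exact absurd (h.2 hK) (not_le.2 (hlt K h.1 hne))
  · rintro rfl
    refine ⟨hK, fun L hLS => ?_⟩
    by_cases hne : L = K
    · rw [hne]; exact le_refl (cost A B Q R z K)
    · exact (hlt L hLS hne).le
  · obtain ⟨X', hX', -⟩ := existsUnique_solvesLyapunov (Q := Q) (R := R) h.1
    have hs' := hX'.isSymm hQ hR h.1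
    have hG' := gradFactor_eq_zero hz hR h.1 hs' hX' fun D ε hε =>
      (h.2.eventually_line D hε).mono fun t ht _ => ht
    exact eq_of_gradFactor_eq_zero hR hK h.1 hsymm hs' hL hX' hG hG' hP
  · rintro rfl
    exact ⟨hK, isStationaryPoint_of_gradFactor_eq_zero hR hK hsymm hL hG⟩
  · have hfix := dare_sub_eq hQ hR hsymm (hL.eq_add_of_gradFactor_eq_zero hG)
      (mul_eq_of_gradFactor_eq_zero hG) h.1.eq_add
      (mul_eq_of_gradFactor_eq_zero (gradFactor_dareGain h.1.1))
    exact (sub_eq_zero.1 (eq_zero_of_eq_transpose_mul_mul hK h.2 hfix)).symm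
  · rintro rfl
    refine ⟨hDARE, ?_⟩
    have hle : specRadius (A - B * Ks) ≤ 1 := le_of_lt hK
    rwa [eq_dareGain hP.isUnit hG] at hle
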